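/- Let $n,s$ be integers with $0\le s\le n$. For integers $m\ge 0$ and $i\ge 0$ let $\mathcal P(m,i)$ be the set of partitions of $m$ into exactly $i$ (positive) parts. For partitions $p,q$ of $n$ write $p\le q$ if $p$ can be obtained from $q$ by summing some of the parts of $q$ and reordering. A monic real polynomial is called hyperbolic if all its roots are real; for a monic hyperbolic polynomial $G$ of degree $n$ let $p(G)$ be the partition of $n$ formed by the multiplicities of its distinct roots. For a monic hyperbolic polynomial $F=T^n+F_1T^{n-1}+\dots+F_n$ let the hyperbolic slice $\mathcal H_s(F)$ be the set of all monic hyperbolic polynomials $T^n+H_1T^{n-1}+\dots+H_n$ with $H_i=F_i$ for $1\le i\le s$. A set $P\subseteq\mathcal P(n,s)$ is an $(n,s)$-Vandermonde covering if for every monic hyperbolic polynomial $F$ of degree $n$ there are $q\in P$ and $G\in\mathcal H_s(F)$ with $p(G)\le q$. Theorem. Every $(n,s)$-Vandermonde covering $P$ satisfies $$|P|\;\ge\;\sum_{i=0}^{\lfloor s/2\rfloor}B_i,$$ where $B_0=0$, $B_1=1$ and $$B_i=\left\lceil \frac{2\bigl(|\mathcal P(n-s+1,i)|-iB_{i-1}-B_{i-2}\bigr)}{i^2+i}\right\rceil\qquad\text{for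 } i\ge 2 .$$ -/

import Mathlib

open Polynomial

namespace VandermondeCovering

/-- The monic hyperbolic polynomials of degree `n`: monic real polynomials of degree `n`
all of whose roots are real. -/
def hyperbolic (n : ℕ) : Set ℝ[X] :=
  {F | F.Monic ∧ F.natDegree = n ∧ F.Splits}

/-- For `F = T ^ n + F₁ T ^ (n - 1) + ⋯ + Fₙ`, the hyperbolic slice `ℋ_s(F)` of all monic
hyperbolic polynomials `T ^ n + H₁ T ^ (n - 1) + ⋯ + Hₙ` with `Hᵢ = Fᵢ` for `1 ≤ i ≤ s`
(where `s ≤ n`). -/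
def hyperbolicSlice (n s : ℕ) (F : ℝ[X]) : Set ℝ[X] :=
  {H | H ∈ hyperbolic n ∧ ∀ i ∈ Finset.Icc 1 s, H.coeff (n - i) = F.coeff (n - i)}

theorem card_roots_of_mem_hyperbolic {n : ℕ} {G : ℝ[X]} (hG : G ∈ hyperbolic n) :
    Multiset.card G.roots = n := by
  rw [← hG.2.1]
  exact hG.2.2.natDegree_eq_card_roots.symm

/-- The partition `p(G)` of `n` formed by the multiplicities of the distinct roots of a monic
hyperbolic polynomial `G` of degree `n`. -/
noncomputable def rootPartition {n : ℕ} (G : ℝ[X]) (hG : G ∈ hyperbolic n) : n.Partition :=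
  Nat.Partition.ofSym (⟨G.roots, card_roots_of_mem_hyperbolic hG⟩ : Sym ℝ n)

/-- `MergeLE p q` is the order `p ≤ q` on partitions of `n`: `p` is obtained from `q` by summing
some of the parts, i.e. the multiset of parts of `q` can be split into blocks whose sums are the
parts of `p`. (The blocks are nonempty because parts of `p` are positive.) -/
def MergeLE {n : ℕ} (p q : n.Partition) : Prop :=
  ∃ blocks : Multiset (Multiset ℕ),
    blocks.join = q.parts ∧ blocks.map Multiset.sum = p.parts

/-- The set `𝒫(n, s)` of partitions of `n` into exactly `s` parts. -/
def partitionsInto (n s : ℕ) : Finset n.Partition :=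
  Finset.univ.filter fun p => Multiset.card p.parts = s

/-- `P ⊆ 𝒫(n, s)` is an `(n, s)`-Vandermonde covering if every hyperbolic slice `ℋ_s(F)`
contains some `G` with `p(G) ≤ q` for some `q ∈ P`. -/
def IsVandermondeCovering (n s : ℕ) (P : Finset n.Partition) : Prop :=
  P ⊆ partitionsInto n s ∧
    ∀ F ∈ hyperbolic n, ∃ q ∈ P, ∃ (G : ℝ[X]) (hG : G ∈ hyperbolicSlice n s F),
      MergeLE (rootPartition G hG.1) q

/-- The integers `B_i` of the recursive bound, for given `n` and `s ≤ n`. -/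
def B (n s : ℕ) : ℕ → ℤ
  | 0 => 0
  | 1 => 1
  | i + 2 =>
      ⌈(2 * (((partitionsInto (n - s + 1) (i + 2)).card : ℚ)
          - ((i + 2 : ℕ) : ℚ) * (B n s (i + 1) : ℚ) - (B n s i : ℚ)))
        / (((i + 2 : ℕ) : ℚ) ^ 2 + ((i + 2 : ℕ) : ℚ))⌉

end VandermondeCovering

namespace VandermondeCovering

/-! Write s = d + 1 and call a part big if it is at least 2. The bound comes from slices consisting
of a single polynomial: there the covering must dominate one prescribed partition.

Rigidity: let F have roots 0, …, d - 1, those at odd positions being simple. If H lies in its slice,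
the ordered roots x of H and y of F satisfy ∑ g(x_j) = ∑ g(y_j) for every g of degree at most d + 1.
A suitable g, built from its derivative, has g(x_j) > g(y_j) whenever x_j ≠ y_j, so H = F
(`eq_of_sum_pow_eq`).

Counting: a partition of n - d into i ≤ (d + 1)/2 parts, with 1 added to each part and padded by
ones to d parts, is a partition of n with exactly i big parts. Alternating big parts with ones makes
it the root partition of a rigid F. Some q in P, having d + 1 parts, must yield it by adding two
parts. With x_j the number of q in P with j big parts, this gives |𝒫(n - d, i)| ≤ C(i + 1, 2)
x_{i+1} + i x_i + x_{i-1} (`card_partitionsInto_le`). Induction on partial sums turns these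
inequalities into the recursion for B (`sum_B_le`). -/

/-- A multiset of reals of cardinality `n` can be listed monotonically. -/
theorem exists_monotone_map_eq {n : ℕ} (S : Multiset ℝ) (hS : Multiset.card S = n) :
    ∃ x : Fin n → ℝ, Monotone x ∧ Finset.univ.val.map x = S := by
  obtain ⟨l, rfl⟩ : ∃ l : List ℝ, (l : Multiset ℝ) = S := Quot.exists_rep S
  rw [Multiset.coe_card] at hS
  subst hS
  refine ⟨l.get ∘ Tuple.sort l.get, Tuple.monotone_sort _, ?_⟩
  rw [← Multiset.map_map, Multiset.map_univ_val_equiv]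
  simp

/-! ### Power sums on a hyperbolic slice -/

/-- Families with the same first `s` elementary symmetric functions have the same first `s`
power sums. -/
theorem sum_pow_eq_of_esymm_eq {n s : ℕ} (x y : Fin n → ℝ)
    (h : ∀ k, 1 ≤ k → k ≤ s →
      (Finset.univ.val.map x).esymm k = (Finset.univ.val.map y).esymm k) :
    ∀ k, k ≤ s → ∑ j, x j ^ k = ∑ j, y j ^ k := by
  have hp : ∀ (z : Fin n → ℝ) k,
      MvPolynomial.aeval z (MvPolynomial.psum (Fin n) ℝ k) = ∑ j, z j ^ k := by
    intro z k
    simp [MvPolynomial.psum]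
  intro k
  induction k using Nat.strong_induction_on with
  | _ k ih =>
    intro hk
    rcases Nat.eq_zero_or_pos k with rfl | hk0
    · simp
    · rw [← hp, ← hp, MvPolynomial.psum_eq_mul_esymm_sub_sum _ _ k hk0]
      simp only [map_sub, map_sum, map_mul, map_pow, map_neg, map_one, map_natCast,
        MvPolynomial.aeval_esymm_eq_multiset_esymm, hp]
      rw [h k hk0 hk]
      congr 1
      refine Finset.sum_congr rfl fun a ha => ?_
      obtain ⟨ha1, ha2⟩ := Finset.mem_filter.1 ha
      have ha3 := Finset.HasAntidiagonal.mem_antidiagonal.1 ha1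
      rw [Set.mem_Ioo] at ha2
      rw [h a.1 (by omega) (by omega), ih a.2 (by omega) (by omega)]

theorem sum_eval_eq_of_sum_pow_eq {n s : ℕ} (x y : Fin n → ℝ)
    (h : ∀ k, k ≤ s → ∑ j, x j ^ k = ∑ j, y j ^ k) (g : ℝ[X]) (hg : g.natDegree ≤ s) :
    ∑ j, g.eval (x j) = ∑ j, g.eval (y j) := by
  simp only [Polynomial.eval_eq_sum_range]
  rw [Finset.sum_comm, Finset.sum_comm (s := Finset.univ)]
  refine Finset.sum_congr rfl fun i hi => ?_
  rw [← Finset.mul_sum, ← Finset.mul_sum, h i (by simp at hi; omega)]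

theorem esymm_roots_eq_of_mem_hyperbolicSlice {n s : ℕ} (hs : s ≤ n) {F H : ℝ[X]}
    (hF : F ∈ hyperbolic n) (hH : H ∈ hyperbolicSlice n s F) {k : ℕ} (h1 : 1 ≤ k) (hk : k ≤ s) :
    H.roots.esymm k = F.roots.esymm k := by
  have key : ∀ {G : ℝ[X]}, G ∈ hyperbolic n → G.coeff (n - k) = (-1) ^ k * G.roots.esymm k := by
    intro G hG
    have := Polynomial.coeff_eq_esymm_roots_of_card (p := G) (k := n - k)
      (by rw [card_roots_of_mem_hyperbolic hG, hG.2.1]) (by rw [hG.2.1]; omega)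
    rw [this, hG.1.leadingCoeff, hG.2.1, one_mul, Nat.sub_sub_self (by omega)]
  have := hH.2 k (by simp; omega)
  rw [key hH.1, key hF] at this
  exact mul_left_cancel₀ (pow_ne_zero _ (by norm_num)) this

theorem exists_derivative_eq (f : ℝ[X]) :
    ∃ g : ℝ[X], derivative g = f ∧ g.natDegree ≤ f.natDegree + 1 := by
  refine ⟨∑ i ∈ Finset.range (f.natDegree + 1), C (f.coeff i / (i + 1)) * X ^ (i + 1), ?_, ?_⟩
  · conv_rhs => rw [f.as_sum_range_C_mul_X_pow]
    rw [derivative_sum]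
    refine Finset.sum_congr rfl fun i _ => ?_
    rw [derivative_C_mul_X_pow]
    have : (i : ℝ) + 1 ≠ 0 := by positivity
    push_cast
    rw [div_mul_cancel₀ _ this]
  · refine natDegree_sum_le_of_forall_le _ _ fun i hi => ?_
    refine (natDegree_C_mul_X_pow_le _ _).trans ?_
    simp at hi
    omega

/-! ### Rigidity when every second root is simple -/

/-- A polynomial with nonzero derivative that is nonnegative on an interval increases strictly
along it. -/
theorem eval_lt_eval_of_derivative_nonneg {g : ℝ[X]} (hg : derivative g ≠ 0) {a b : ℝ}
    (hab : a < b) (h : ∀ τ, a < τ → τ < b → 0 ≤ (derivative g).eval τ) :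
    g.eval a < g.eval b := by
  have hm : MonotoneOn (fun t => g.eval t) (Set.Icc a b) := by
    refine monotoneOn_of_deriv_nonneg (convex_Icc a b) g.continuous.continuousOn
      g.differentiable.differentiableOn fun τ hτ => ?_
    rw [interior_Icc] at hτ
    rw [Polynomial.deriv]
    exact h τ hτ.1 hτ.2
  refine lt_of_le_of_ne (hm ⟨le_rfl, hab.le⟩ ⟨hab.le, le_rfl⟩ hab.le) fun heq => hg ?_
  have : g = C (g.eval a) := by
    refine eq_of_infinite_eval_eq _ _ ((Set.Icc_infinite hab).mono fun t ht => ?_)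
    simp only [Set.mem_ofPred_eq, eval_C]
    refine le_antisymm ?_ (hm ⟨le_rfl, hab.le⟩ ht ht.1)
    rw [heq]
    exact hm ht ⟨hab.le, le_rfl⟩ ht.2
  rw [this, derivative_C]

/-- The sign of a product of linear factors with ordered roots. -/
theorem prod_sub_sign {r : ℕ → ℝ} {d k : ℕ} (hk : k ≤ d) {τ : ℝ}
    (h1 : ∀ i < k, r i ≤ τ) (h2 : ∀ i < d, k ≤ i → τ ≤ r i) :
    0 ≤ (-1) ^ (d - k) * ∏ i ∈ Finset.range d, (τ - r i) := by
  rw [← Finset.prod_range_mul_prod_Ico _ hk]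
  have e : ∏ i ∈ Finset.Ico k d, (τ - r i) = (-1) ^ (d - k) * ∏ i ∈ Finset.Ico k d, (r i - τ) := by
    rw [← Nat.card_Ico, ← Finset.prod_const, ← Finset.prod_mul_distrib]
    exact Finset.prod_congr rfl fun i _ => by ring
  rw [e, mul_left_comm, ← mul_assoc ((-1 : ℝ) ^ (d - k)), ← mul_pow]
  norm_num
  refine mul_nonneg (Finset.prod_nonneg fun i hi => ?_) (Finset.prod_nonneg fun i hi => ?_)
  · simp at hi; linarith [h1 i hi]
  · simp at hi; linarith [h2 i hi.2 hi.1]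

/-- If `y` takes the values `t 0 < ⋯ < t (d - 1)`, those with odd index exactly once each, and `x`
has the same first `d + 1` power sums, then `x = y`. -/
theorem eq_of_sum_pow_eq {n d : ℕ} (hd : 0 < d) {t : ℕ → ℝ} (ht : StrictMono t)
    {x y : Fin n → ℝ} (hx : Monotone x)
    (hy : Monotone y) (hval : ∀ j, ∃ i < d, y j = t i)
    (e : ℕ → Fin n) (he : ∀ m, 2 * m + 1 < d → y (e m) = t (2 * m + 1))
    (he' : ∀ m, 2 * m + 1 < d → ∀ j, y j = t (2 * m + 1) → j = e m)
    (hxd : ∀ j, x j ≤ t d)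
    (h : ∀ k, k ≤ d + 1 → ∑ j, x j ^ k = ∑ j, y j ^ k) : x = y := by
  -- The r i are to be the critical points of g: minima at the even t i, where y may have multiple
  -- values, and maxima at the odd places, moved to the new position of the simple value and clamped
  -- between the neighbouring minima.
  set r : ℕ → ℝ := fun i =>
    if Even i then t i else max (t (i - 1)) (min (x (e (i / 2))) (t (i + 1))) with hr
  have r_even : ∀ m, r (2 * m) = t (2 * m) := fun m => by simp [hr]
  have r_odd : ∀ m, r (2 * m + 1) = max (t (2 * m)) (min (x (e m)) (t (2 * m + 2))) := fun m => by
    have : (2 * m + 1) / 2 = m := by omega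
    simp [hr, this]
  have hrm : Monotone r := by
    refine monotone_nat_of_le_succ fun i => ?_
    obtain ⟨m, rfl | rfl⟩ := Nat.even_or_odd' i
    · rw [r_even, r_odd]; exact le_max_left _ _
    · rw [r_odd, show 2 * m + 1 + 1 = 2 * (m + 1) by ring, r_even]
      exact max_le (ht.monotone (by omega)) (min_le_right _ _)
  -- The sign makes f nonnegative where an odd number of the r i lie to the left of τ, hence just to
  -- the right of an even t i.
  set f : ℝ[X] := C ((-1) ^ (d + 1)) * ∏ i ∈ Finset.range d, (X - C (r i)) with hf
  have hf0 : f ≠ 0 := mul_ne_zero (by simp) (Finset.prod_ne_zero_iff.2 fun i _ => X_sub_C_ne_zero _)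
  have hfd : f.natDegree ≤ d := by
    refine (natDegree_C_mul_le _ _).trans ?_
    rw [natDegree_prod_of_monic _ _ fun i _ => monic_X_sub_C _]
    simp
  have hfe : ∀ τ, f.eval τ = (-1) ^ (d + 1) * ∏ i ∈ Finset.range d, (τ - r i) := fun τ => by
    simp [hf, eval_prod]
  obtain ⟨g, hg, hgd⟩ := exists_derivative_eq f
  have hsgn : ∀ τ, ∃ k ≤ d, (∀ i < k, r i ≤ τ) ∧ (k < d → τ < r k) ∧
      0 ≤ (-1) ^ (k + 1) * f.eval τ := by
    intro τ
    by_cases hex : ∃ k, k < d ∧ τ < r k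
    · classical
      obtain ⟨hk, hkτ⟩ := Nat.find_spec hex
      set k := Nat.find hex
      have h1 : ∀ i < k, r i ≤ τ := fun i hi => by
        have := Nat.find_min hex hi
        by_contra hc
        exact this ⟨by omega, not_le.1 hc⟩
      refine ⟨k, hk.le, h1, fun _ => hkτ, ?_⟩
      have := prod_sub_sign hk.le h1 (fun i _ hki => hkτ.le.trans (hrm hki))
      rw [hfe, ← mul_assoc, ← pow_add]
      convert this using 2
      rw [show k + 1 + (d + 1) = d - k + 2 * (k + 1) by omega, pow_add, pow_mul]
      simp
    · push Not at hex
      refine ⟨d, le_rfl, hex, fun h => absurd h (lt_irrefl _), ?_⟩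
      have := prod_sub_sign le_rfl hex (fun i h1 h2 => absurd h1 (not_lt.2 h2))
      rw [hfe, ← mul_assoc, ← pow_add, ← two_mul, pow_mul]
      simpa using this
  have hright : ∀ j τ, y j < τ → τ < x j → 0 ≤ f.eval τ := by
    intro j τ h1 h2
    obtain ⟨k, hkd, hk1, hk2, hk3⟩ := hsgn τ
    obtain ⟨i, hid, hi⟩ := hval j
    rcases Nat.even_or_odd k with hk | hk
    · exfalso
      -- For k = d there is no root r d to the right; the bound `hxd` replaces it.
      have hτ : τ < t k := by
        rcases hkd.lt_or_eq with hlt | rfl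
        · have := hk2 hlt
          simpa only [hr, if_pos hk] using this
        · exact h2.trans_le (hxd j)
      have hik : i < k := ht.lt_iff_lt.1 (by linarith)
      obtain ⟨m, rfl⟩ : ∃ m, k = 2 * m + 2 := by
        obtain ⟨a, rfl⟩ := hk
        exact ⟨a - 1, by omega⟩
      have hc := hk1 (2 * m + 1) (by omega)
      rw [r_odd] at hc
      have hxe : x (e m) ≤ τ := by
        rcases min_le_iff.1 ((le_max_right _ _).trans hc) with h | h
        · exact h
        · exact absurd hτ (not_lt.2 h)
      -- Monotonicity of y now forces y j = t (2m + 1), a value taken only at e m.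
      have hej : e m < j := hx.reflect_lt (hxe.trans_lt h2)
      have hle := hy hej.le
      rw [he m (by omega), hi, ht.le_iff_le] at hle
      have : i ≠ 2 * m + 1 := by
        rintro rfl
        exact hej.ne' (he' m (by omega) j hi)
      omega
    · simpa [hk.add_one.neg_one_pow] using hk3
  have hleft : ∀ j τ, x j < τ → τ < y j → f.eval τ ≤ 0 := by
    intro j τ h1 h2
    obtain ⟨k, hkd, hk1, hk2, hk3⟩ := hsgn τ
    obtain ⟨i, hid, hi⟩ := hval j
    rcases Nat.even_or_odd k with hk | hk
    · simpa [hk.add_one.neg_one_pow] using hk3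
    · exfalso
      obtain ⟨m, rfl⟩ := hk
      have hτ := hk1 (2 * m) (by omega)
      rw [r_even] at hτ
      have hi2 : 2 * m < i := ht.lt_iff_lt.1 (by linarith)
      have hlt : 2 * m + 1 < d := by omega
      have hc := hk2 hlt
      rw [r_odd, lt_max_iff] at hc
      have hxe : τ < x (e m) := by
        rcases hc with h | h
        · exact absurd h (not_lt.2 hτ)
        · exact h.trans_le (min_le_left _ _)
      have hej : j < e m := hx.reflect_lt (h1.trans hxe)
      have hle := hy hej.le
      rw [he m hlt, hi, ht.le_iff_le] at hle
      have : i ≠ 2 * m + 1 := by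
        rintro rfl
        exact hej.ne (he' m (by omega) j hi)
      omega
  have hlt : ∀ j, x j ≠ y j → g.eval (y j) < g.eval (x j) := by
    intro j hj
    rcases lt_or_gt_of_ne hj with hj | hj
    · have := eval_lt_eval_of_derivative_nonneg (g := -g) (by simpa [hg] using hf0) hj
        fun τ h1 h2 => by simpa [hg] using hleft j τ h1 h2
      simpa using this
    · exact eval_lt_eval_of_derivative_nonneg (by simpa [hg] using hf0) hj
        fun τ h1 h2 => by simpa [hg] using hright j τ h1 h2
  have hsum := sum_eval_eq_of_sum_pow_eq x y h g (by omega)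
  by_contra hne
  obtain ⟨j, hj⟩ := Function.ne_iff.1 hne
  refine absurd hsum (ne_of_gt (Finset.sum_lt_sum (fun i _ => ?_) ⟨j, Finset.mem_univ _, hlt j hj⟩))
  by_cases hi : x i = y i
  · rw [hi]
  · exact (hlt i hi).le

/-- A hyperbolic polynomial with roots among `0, …, d - 1` in which every second root is simple is
the only element of its slice fixing `d + 1` coefficients. -/
theorem eq_of_mem_hyperbolicSlice {n d : ℕ} (hd : 0 < d) (hdn : d + 1 ≤ n) {F H : ℝ[X]}
    (hF : F ∈ hyperbolic n) (hroots : ∀ a ∈ F.roots, ∃ i : ℕ, i < d ∧ a = i)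
    (hsimple : ∀ m : ℕ, 2 * m + 1 < d → F.roots.count ((2 * m + 1 : ℕ) : ℝ) = 1)
    (hH : H ∈ hyperbolicSlice n (d + 1) F) : H = F := by
  obtain ⟨x, hx, hxr⟩ := exists_monotone_map_eq H.roots (card_roots_of_mem_hyperbolic hH.1)
  obtain ⟨y, hy, hyr⟩ := exists_monotone_map_eq F.roots (card_roots_of_mem_hyperbolic hF)
  have hps := sum_pow_eq_of_esymm_eq (s := d + 1) x y fun k h1 hk => by
    rw [hxr, hyr]; exact esymm_roots_eq_of_mem_hyperbolicSlice hdn hF hH h1 hk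
  have hn : 0 < n := by omega
  have hex : ∀ m, ∃ j : Fin n, 2 * m + 1 < d →
      y j = ((2 * m + 1 : ℕ) : ℝ) ∧ ∀ i, y i = ((2 * m + 1 : ℕ) : ℝ) → i = j := by
    intro m
    by_cases hm : 2 * m + 1 < d
    · have h1 := hsimple m hm
      rw [← hyr, Multiset.count_map] at h1
      have h2 : (Finset.univ.filter fun j => ((2 * m + 1 : ℕ) : ℝ) = y j).card = 1 := h1
      obtain ⟨j, hj⟩ := Finset.card_eq_one.1 h2
      refine ⟨j, fun _ => ⟨?_, fun i hi => ?_⟩⟩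
      · have : j ∈ Finset.univ.filter fun j => ((2 * m + 1 : ℕ) : ℝ) = y j := by rw [hj]; simp
        simpa using (Finset.mem_filter.1 this).2.symm
      · have : i ∈ Finset.univ.filter fun j => ((2 * m + 1 : ℕ) : ℝ) = y j := by simp [hi]
        rw [hj] at this
        simpa using this
    · exact ⟨⟨0, hn⟩, fun h => absurd h hm⟩
  choose e he using hex
  obtain ⟨M, hM⟩ : ∃ M : ℝ, 0 ≤ M ∧ ∀ j, x j ≤ M :=
    ⟨∑ j, |x j|, Finset.sum_nonneg fun j _ => abs_nonneg _, fun j => (le_abs_self _).trans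
      (Finset.single_le_sum (f := fun j => |x j|) (fun j _ => abs_nonneg _) (Finset.mem_univ j))⟩
  -- The shift by M from index d on puts t d above all roots of H and keeps t strictly increasing.
  set t : ℕ → ℝ := fun i => i + if i < d then 0 else M with ht
  have htd : ∀ i < d, t i = i := fun i hi => by simp [ht, hi]
  have htm : StrictMono t := by
    refine strictMono_nat_of_lt_succ fun i => ?_
    simp only [ht]
    push_cast
    split_ifs with h1 h2
    · linarith
    · linarith [hM.1]
    · omega
    · linarith
  have hxy : x = y := by
    refine eq_of_sum_pow_eq hd htm hx hy (fun j => ?_) e (fun m hm => ?_) (fun m hm j hj => ?_)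
      (fun j => ?_) hps
    · obtain ⟨i, hi, h⟩ := hroots (y j) (by rw [← hyr]; exact Multiset.mem_map_of_mem _ (by simp))
      exact ⟨i, hi, by rw [h, htd i hi]⟩
    · rw [htd _ hm]; exact (he m hm).1
    · rw [htd _ hm] at hj; exact (he m hm).2 j hj
    · have : (0 : ℝ) ≤ d := by positivity
      simp only [ht, lt_irrefl, if_false]
      linarith [hM.2 j]
  rw [hH.1.2.2.eq_prod_roots_of_monic hH.1.1, hF.2.2.eq_prod_roots_of_monic hF.1, ← hxr, ← hyr, hxy]

/-! ### Realising partitions by root multiplicities -/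

theorem map_range_eq_add (f : ℕ → ℕ) (a b : ℕ) (h : a = b ∨ a = b + 1) :
    (Multiset.range (a + b)).map f =
      (Multiset.range a).map (fun k => f (2 * k)) + (Multiset.range b).map (fun k => f (2 * k + 1)) := by
  induction b generalizing a with
  | zero => rcases h with rfl | rfl <;> simp
  | succ b ih =>
    have key : (Multiset.range (b + 1 + (b + 1))).map f =
        (Multiset.range (b + 1)).map (fun k => f (2 * k)) +
          (Multiset.range (b + 1)).map (fun k => f (2 * k + 1)) := by
      have := ih (b + 1) (Or.inr rfl)
      rw [show b + 1 + (b + 1) = (b + 1 + b) + 1 by ring, Multiset.range_succ, Multiset.map_cons, this,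
        Multiset.range_succ b, Multiset.map_cons (fun k => f (2 * k + 1)),
        show b + 1 + b = 2 * b + 1 by ring, Multiset.add_cons]
    rcases h with rfl | rfl
    · exact key
    · rw [show b + 1 + 1 + (b + 1) = (b + 1 + (b + 1)) + 1 by ring, Multiset.range_succ,
        Multiset.map_cons, key, Multiset.range_succ (b + 1), Multiset.map_cons (fun k => f (2 * k)),
        Multiset.cons_add, show b + 1 + (b + 1) = 2 * (b + 1) by ring]

/-- Prescribed multiplicities at the points `0, …, d - 1` are realised by a hyperbolic
polynomial. -/
theorem exists_mem_hyperbolic {n d : ℕ} (m : ℕ → ℕ) (hm : ∀ i < d, 0 < m i) (p : n.Partition)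
    (hp : p.parts = (Multiset.range d).map m) :
    ∃ (F : ℝ[X]) (hF : F ∈ hyperbolic n), rootPartition F hF = p ∧
      (∀ a ∈ F.roots, ∃ i : ℕ, i < d ∧ a = i) ∧ ∀ i < d, F.roots.count (i : ℝ) = m i := by
  set S : Multiset ℝ := ∑ i ∈ Finset.range d, Multiset.replicate (m i) (i : ℝ) with hS
  have hcount : ∀ i < d, S.count (i : ℝ) = m i := by
    intro i hi
    rw [hS, Multiset.count_sum']
    simp only [Multiset.count_replicate, Nat.cast_inj]
    rw [Finset.sum_ite_eq' (Finset.range d) i m, if_pos (Finset.mem_range.2 hi)]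
  have hmem : ∀ a ∈ S, ∃ i : ℕ, i < d ∧ a = i := by
    intro a ha
    rw [hS, Multiset.mem_sum] at ha
    obtain ⟨i, hi, ha⟩ := ha
    exact ⟨i, Finset.mem_range.1 hi, Multiset.eq_of_mem_replicate ha⟩
  have hcard : Multiset.card S = n := by
    rw [hS, Multiset.card_sum, ← p.parts_sum, hp]
    simp [Finset.sum]
  have hdedup : S.dedup = (Multiset.range d).map (fun i : ℕ => (i : ℝ)) := by
    refine (Multiset.Nodup.ext (Multiset.nodup_dedup _)
      ((Multiset.nodup_range d).map Nat.cast_injective)).2 fun a => ?_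
    rw [Multiset.mem_dedup, Multiset.mem_map]
    constructor
    · intro ha
      obtain ⟨i, hi, rfl⟩ := hmem a ha
      exact ⟨i, Multiset.mem_range.2 hi, rfl⟩
    · rintro ⟨i, hi, rfl⟩
      rw [Multiset.mem_range] at hi
      rw [← Multiset.count_pos, hcount i hi]
      exact hm i hi
  set F : ℝ[X] := (S.map fun a => X - C a).prod with hFdef
  have hroots : F.roots = S := roots_multiset_prod_X_sub_C S
  have hF : F ∈ hyperbolic n := by
    refine ⟨monic_multiset_prod_of_monic _ _ fun a _ => monic_X_sub_C a, ?_, ?_⟩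
    · rw [hFdef, natDegree_multiset_prod_X_sub_C_eq_card, hcard]
    · refine Splits.multisetProd fun f hf => ?_
      obtain ⟨a, _, rfl⟩ := Multiset.mem_map.1 hf
      exact Splits.X_sub_C a
  refine ⟨F, hF, ?_, ?_, ?_⟩
  · ext1
    change F.roots.dedup.map (fun a => F.roots.count a) = p.parts
    rw [hroots, hdedup, hp, Multiset.map_map]
    exact Multiset.map_congr rfl fun i hi => hcount i (Multiset.mem_range.1 hi)
  · rwa [hroots]
  · rwa [hroots]

/-! ### Merging two parts -/

theorem join_eq_map_sum_of_sum_card_le (blocks : Multiset (Multiset ℕ)) (h0 : ∀ b ∈ blocks, b ≠ 0)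
    (h : Multiset.card blocks.join ≤ Multiset.card blocks) :
    blocks.join = blocks.map Multiset.sum := by
  induction blocks using Multiset.induction_on with
  | empty => simp
  | cons b bs ih =>
    have hb := Multiset.card_pos.2 (h0 b (by simp))
    have hbs : Multiset.card bs ≤ Multiset.card bs.join := by
      rw [Multiset.card_join]
      have : ∀ c ∈ bs.map Multiset.card, 1 ≤ c := by
        intro c hc
        obtain ⟨b', hb', rfl⟩ := Multiset.mem_map.1 hc
        exact Multiset.card_pos.2 (h0 b' (by simp [hb']))
      simpa using Multiset.card_nsmul_le_sum this
    simp only [Multiset.join_cons, Multiset.card_add, Multiset.card_cons] at h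
    obtain ⟨a, rfl⟩ := Multiset.card_eq_one.1 (show Multiset.card b = 1 by omega)
    rw [Multiset.join_cons, Multiset.map_cons, ih (fun b hb => h0 b (by simp [hb])) (by omega)]
    simp

/-- Nonempty blocks with one element in excess of their number are singletons except for a single
pair, whose elements are a and b. -/
theorem exists_join_eq_of_sum_card_eq_succ (blocks : Multiset (Multiset ℕ))
    (h0 : ∀ b ∈ blocks, b ≠ 0)
    (h : Multiset.card blocks.join = Multiset.card blocks + 1) :
    ∃ (a b : ℕ) (r : Multiset ℕ), blocks.join = a ::ₘ b ::ₘ r ∧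
      blocks.map Multiset.sum = (a + b) ::ₘ r := by
  induction blocks using Multiset.induction_on with
  | empty => simp at h
  | cons b bs ih =>
    have hb := Multiset.card_pos.2 (h0 b (by simp))
    have hbs : Multiset.card bs ≤ Multiset.card bs.join := by
      rw [Multiset.card_join]
      have : ∀ c ∈ bs.map Multiset.card, 1 ≤ c := by
        intro c hc
        obtain ⟨b', hb', rfl⟩ := Multiset.mem_map.1 hc
        exact Multiset.card_pos.2 (h0 b' (by simp [hb']))
      simpa using Multiset.card_nsmul_le_sum this
    simp only [Multiset.join_cons, Multiset.card_add, Multiset.card_cons] at h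
    rcases (show Multiset.card b = 1 ∨ Multiset.card b = 2 by omega) with hb1 | hb2
    · obtain ⟨c, rfl⟩ := Multiset.card_eq_one.1 hb1
      obtain ⟨x, y, r, h1, h2⟩ := ih (fun b hb => h0 b (by simp [hb])) (by omega)
      refine ⟨x, y, c ::ₘ r, ?_, ?_⟩
      · rw [Multiset.join_cons, h1, Multiset.singleton_add, Multiset.cons_swap c x,
          Multiset.cons_swap c y]
      · rw [Multiset.map_cons, h2, Multiset.sum_singleton, Multiset.cons_swap]
    · obtain ⟨x, y, rfl⟩ := Multiset.card_eq_two.1 hb2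
      refine ⟨x, y, bs.join, by simp, ?_⟩
      rw [Multiset.map_cons, join_eq_map_sum_of_sum_card_le bs (fun b hb => h0 b (by simp [hb]))
        (by omega)]
      simp

/-- A partition below `q` with one part less arises by adding two parts of `q`. -/
theorem MergeLE.exists_eq_cons {n : ℕ} {p q : n.Partition} (h : MergeLE p q)
    (hc : Multiset.card q.parts = Multiset.card p.parts + 1) :
    ∃ (a b : ℕ) (r : Multiset ℕ), q.parts = a ::ₘ b ::ₘ r ∧ p.parts = (a + b) ::ₘ r := by
  obtain ⟨blocks, h1, h2⟩ := h
  rw [← h1, ← h2]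
  refine exists_join_eq_of_sum_card_eq_succ blocks (fun b hb hb0 => ?_) ?_
  · have : b.sum ∈ p.parts := by rw [← h2]; exact Multiset.mem_map_of_mem _ hb
    have := p.parts_pos this
    simp [hb0] at this
  · rw [h1, hc, ← h2, Multiset.card_map]

/-- The elements of a multiset that are at least `2`. -/
def bigParts (A : Multiset ℕ) : Multiset ℕ := A.filter (2 ≤ ·)

/-- A finset containing every multiset with `i` elements exceeding one that arises from the
multiset `A` of positive numbers by adding two of its elements. -/
def mergeCandidates (A : Multiset ℕ) (i : ℕ) : Finset (Multiset ℕ) :=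
  if Multiset.card (bigParts A) = i + 1 then
    (((bigParts A).powersetCard 2).map fun u => u.sum ::ₘ (A - u)).toFinset
  else if Multiset.card (bigParts A) = i then
    ((bigParts A).map fun a => (a + 1) ::ₘ (A - {a, 1})).toFinset
  else if Multiset.card (bigParts A) + 1 = i then {2 ::ₘ (A - {1, 1})}
  else ∅

theorem card_mergeCandidates_le (A : Multiset ℕ) (i : ℕ) :
    (mergeCandidates A i).card ≤
      if Multiset.card (bigParts A) = i + 1 then (i + 1).choose 2
      else if Multiset.card (bigParts A) = i then i
      else if Multiset.card (bigParts A) + 1 = i then 1 else 0 := by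
  unfold mergeCandidates
  split_ifs with h1 h2 h3
  · refine (Multiset.toFinset_card_le _).trans ?_
    rw [Multiset.card_map, Multiset.card_powersetCard, h1]
  · refine (Multiset.toFinset_card_le _).trans ?_
    rw [Multiset.card_map, h2]
  · simp
  · simp

/-- Adding two big parts lowers the number of big parts by one, adding a big part and a one
preserves it, and adding two ones raises it by one; these are the three branches of
`mergeCandidates`. -/
theorem mem_mergeCandidates {a b i : ℕ} {r : Multiset ℕ} (ha : 0 < a) (hb : 0 < b)
    (hi : Multiset.card (bigParts ((a + b) ::ₘ r)) = i) :
    (a + b) ::ₘ r ∈ mergeCandidates (a ::ₘ b ::ₘ r) i := by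
  have hpair : ∀ c d : ℕ, c ::ₘ d ::ₘ r - {c, d} = r := fun c d => by
    rw [show c ::ₘ d ::ₘ r = {c, d} + r by simp [Multiset.insert_eq_cons], add_tsub_cancel_left]
  have hab : 2 ≤ a + b := by omega
  have hone : ∀ c, 2 ≤ c → Multiset.card (bigParts ((c + 1) ::ₘ r)) = i →
      (c + 1) ::ₘ r ∈ mergeCandidates (c ::ₘ 1 ::ₘ r) i := by
    intro c hc hi
    have hcard : Multiset.card (bigParts (c ::ₘ 1 ::ₘ r)) = i := by
      rw [← hi]; simp [bigParts, hc, show 2 ≤ c + 1 by omega]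
    rw [mergeCandidates, if_neg (by omega), if_pos hcard, Multiset.mem_toFinset, Multiset.mem_map]
    refine ⟨c, ?_, by rw [hpair]⟩
    simp [bigParts, hc]
  by_cases ha2 : 2 ≤ a <;> by_cases hb2 : 2 ≤ b
  · have hcard : Multiset.card (bigParts (a ::ₘ b ::ₘ r)) = i + 1 := by
      rw [← hi]; simp [bigParts, ha2, hb2, hab]
    rw [mergeCandidates, if_pos hcard, Multiset.mem_toFinset, Multiset.mem_map]
    refine ⟨{a, b}, ?_, ?_⟩
    · rw [Multiset.mem_powersetCard]
      refine ⟨?_, by simp⟩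
      simp only [bigParts, Multiset.filter_cons_of_pos _ ha2, Multiset.filter_cons_of_pos _ hb2]
      exact Multiset.cons_le_cons _ (Multiset.cons_le_cons _ (Multiset.zero_le _))
    · rw [hpair]; simp
  · obtain rfl : b = 1 := by omega
    exact hone a ha2 hi
  · obtain rfl : a = 1 := by omega
    rw [Multiset.cons_swap]
    rw [add_comm] at hi ⊢
    exact hone b hb2 hi
  · obtain rfl : a = 1 := by omega
    obtain rfl : b = 1 := by omega
    have hcard : Multiset.card (bigParts (1 ::ₘ 1 ::ₘ r)) + 1 = i := by
      rw [← hi]; simp [bigParts]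
    rw [mergeCandidates, if_neg (by omega), if_neg (by omega), if_pos hcard, hpair]
    simp

/-- A partition with `d` parts of which at most `(d + 1) / 2` exceed one can be listed so that
every second part is one. -/
theorem exists_alternating_list {d : ℕ} (A : Multiset ℕ) (hA : Multiset.card A = d)
    (hpos : ∀ a ∈ A, 0 < a) (hbig : Multiset.card (bigParts A) ≤ (d + 1) / 2) :
    ∃ m : ℕ → ℕ, A = (Multiset.range d).map m ∧ ∀ k, m (2 * k + 1) = 1 := by
  have hsplit : A = bigParts A + Multiset.replicate (d - Multiset.card (bigParts A)) 1 := by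
    have h1 := Multiset.filter_add_not (2 ≤ ·) A
    have h2 : A.filter (fun a => ¬ 2 ≤ a) =
        Multiset.replicate (Multiset.card (A.filter fun a => ¬ 2 ≤ a)) 1 := by
      refine Multiset.eq_replicate_card.2 fun a ha => ?_
      have := hpos a (Multiset.mem_of_mem_filter ha)
      have := Multiset.of_mem_filter ha
      omega
    have h3 := congrArg Multiset.card h1
    rw [Multiset.card_add, hA] at h3
    have h4 : Multiset.card (A.filter fun a => ¬ 2 ≤ a) = d - Multiset.card (bigParts A) := by
      unfold bigParts; omega
    rw [h4] at h2
    rw [h2] at h1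
    exact h1.symm
  set c := (d + 1) / 2 with hc
  -- The list l fills the c even positions below d: all big parts, then ones.
  obtain ⟨l, hl⟩ : ∃ l : List ℕ, (l : Multiset ℕ) =
      bigParts A + Multiset.replicate (c - Multiset.card (bigParts A)) 1 := Quot.exists_rep _
  have hlen : l.length = c := by
    have := congrArg Multiset.card hl
    simp at this
    omega
  refine ⟨fun i => if Even i then l.getD (i / 2) 1 else 1, ?_, fun k => by simp⟩
  have hd : d = c + d / 2 := by omega
  conv_rhs => rw [hd]
  rw [map_range_eq_add _ c (d / 2) (by omega)]
  have he : (Multiset.range c).map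
      (fun k => if Even (2 * k) then l.getD (2 * k / 2) 1 else 1) = l := by
    rw [← hlen]
    simp only [even_two_mul, if_true, Nat.mul_div_cancel_left _ (show 0 < 2 by norm_num)]
    rw [← Multiset.coe_range, Multiset.map_coe, Multiset.coe_eq_coe]
    refine List.Perm.of_eq (List.ext_getElem (by simp) fun i h1 h2 => ?_)
    simp [List.getElem?_eq_getElem h2]
  have ho : (Multiset.range (d / 2)).map
      (fun k => if Even (2 * k + 1) then l.getD ((2 * k + 1) / 2) 1 else 1) =
        Multiset.replicate (d / 2) 1 := by
    simp
  rw [he, ho, hl, add_assoc, ← Multiset.replicate_add]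
  conv_lhs => rw [hsplit]
  congr 2
  omega

/-! ### The counting inequalities -/

/-- The successors of the elements of `A`, padded with ones to `d` elements. -/
def succPad (d : ℕ) (A : Multiset ℕ) : Multiset ℕ :=
  A.map (· + 1) + Multiset.replicate (d - Multiset.card A) 1

theorem bigParts_succPad (d : ℕ) {A : Multiset ℕ} (hA : ∀ a ∈ A, 0 < a) :
    bigParts (succPad d A) = A.map (· + 1) := by
  rw [bigParts, succPad, Multiset.filter_add, Multiset.filter_eq_self.2, Multiset.filter_eq_nil.2,
    add_zero]
  · intro a ha
    rw [Multiset.eq_of_mem_replicate ha]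
    norm_num
  · intro a ha
    obtain ⟨b, hb, rfl⟩ := Multiset.mem_map.1 ha
    have := hA b hb
    omega

/-- Each padded partition is the root partition of a rigid polynomial, so it is a merge of two parts
of some q in P; the summand bounds how many such merges one q supplies. -/
theorem card_partitionsInto_le {n d i : ℕ} (hd : 0 < d) (hdn : d + 1 ≤ n) (hi : i ≤ (d + 1) / 2)
    {P : Finset n.Partition} (hP : IsVandermondeCovering n (d + 1) P) :
    (partitionsInto (n - d) i).card ≤
      ∑ q ∈ P, if Multiset.card (bigParts q.parts) = i + 1 then (i + 1).choose 2
        else if Multiset.card (bigParts q.parts) = i then i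
        else if Multiset.card (bigParts q.parts) + 1 = i then 1 else 0 := by
  have hinj : Set.InjOn (fun μ : (n - d).Partition => succPad d μ.parts)
      (partitionsInto (n - d) i) := by
    intro μ _ ν _ h
    have := congrArg bigParts h
    simp only [bigParts_succPad d fun _ h => μ.parts_pos h,
      bigParts_succPad d fun _ h => ν.parts_pos h] at this
    exact Nat.Partition.ext (Multiset.map_injective (add_left_injective 1) this)
  rw [← Finset.card_image_of_injOn hinj]
  refine le_trans (Finset.card_le_card (t := P.biUnion fun q => mergeCandidates q.parts i) ?_)
    (Finset.card_biUnion_le.trans (Finset.sum_le_sum fun q _ => card_mergeCandidates_le _ _))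
  intro A hA
  obtain ⟨μ, hμ, rfl⟩ := Finset.mem_image.1 hA
  have hμi : Multiset.card μ.parts = i := (Finset.mem_filter.1 hμ).2
  have hbig : Multiset.card (bigParts (succPad d μ.parts)) = i := by
    rw [bigParts_succPad d fun _ h => μ.parts_pos h, Multiset.card_map, hμi]
  have hcard : Multiset.card (succPad d μ.parts) = d := by
    simp [succPad, hμi]; omega
  have hpos : ∀ a ∈ succPad d μ.parts, 0 < a := by
    intro a ha
    rcases Multiset.mem_add.1 ha with ha | ha
    · obtain ⟨b, _, rfl⟩ := Multiset.mem_map.1 ha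
      omega
    · rw [Multiset.eq_of_mem_replicate ha]; norm_num
  let p : n.Partition := ⟨succPad d μ.parts, fun {a} ha => hpos a ha, by
    have := μ.parts_sum
    simp [succPad, Multiset.sum_map_add, hμi, this]
    omega⟩
  obtain ⟨m, hm, hm1⟩ := exists_alternating_list _ hcard hpos (hbig.trans_le hi)
  have hmpos : ∀ j < d, 0 < m j := fun j hj =>
    hpos _ (by rw [hm]; exact Multiset.mem_map_of_mem _ (Multiset.mem_range.2 hj))
  obtain ⟨F, hF, hFp, hFr, hFc⟩ := exists_mem_hyperbolic m hmpos p hm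
  obtain ⟨q, hq, G, hG, hle⟩ := hP.2 F hF
  obtain rfl : G = F := eq_of_mem_hyperbolicSlice hd hdn hF hFr
    (fun k hk => by rw [hFc _ hk, hm1]) hG
  rw [hFp] at hle
  have hqc : Multiset.card q.parts = d + 1 := (Finset.mem_filter.1 (hP.1 hq)).2
  obtain ⟨a, b, r, h1, h2⟩ := hle.exists_eq_cons (hqc.trans (congrArg (· + 1) hcard.symm))
  refine Finset.mem_biUnion.2 ⟨q, hq, ?_⟩
  have h2' : succPad d μ.parts = (a + b) ::ₘ r := h2
  rw [h1]
  change succPad d μ.parts ∈ _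
  rw [h2']
  refine mem_mergeCandidates (q.parts_pos (by simp [h1])) (q.parts_pos (by simp [h1])) ?_
  rw [← h2', hbig]

theorem sum_ite_eq_card {n : ℕ} (P : Finset n.Partition) (x : ℕ → ℕ)
    (hx : ∀ j, x j = (P.filter fun q => Multiset.card (bigParts q.parts) = j).card) (i : ℕ) :
    (∑ q ∈ P, if Multiset.card (bigParts q.parts) = i + 1 + 1 then (i + 1 + 1).choose 2
        else if Multiset.card (bigParts q.parts) = i + 1 then i + 1
        else if Multiset.card (bigParts q.parts) + 1 = i + 1 then 1 else 0) =
      (i + 1 + 1).choose 2 * x (i + 1 + 1) + (i + 1) * x (i + 1) + x i := by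
  simp only [hx, Finset.card_filter, Finset.mul_sum, ← Finset.sum_add_distrib]
  refine Finset.sum_congr rfl fun q _ => ?_
  split_ifs <;> omega

/-! ### From the inequalities to the recursion -/

/-- The partial sums of `B` bound those of any solution `x` of the counting inequalities. -/
theorem sum_B_le {n s K : ℕ} (x : ℕ → ℕ)
    (h1 : 1 ≤ K → 1 ≤ x 0 + x 1 + x 2)
    (h : ∀ i, i + 2 ≤ K → ((partitionsInto (n - s + 1) (i + 2)).card : ℤ) ≤
      ((i + 3).choose 2 : ℤ) * x (i + 3) + (i + 2) * x (i + 2) + x (i + 1)) :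
    ∀ k ≤ K, ∑ i ∈ Finset.range (k + 1), B n s i ≤ ∑ j ∈ Finset.range (k + 2), (x j : ℤ) := by
  intro k
  induction k using Nat.strong_induction_on with
  | _ k ih =>
    intro hk
    match k, ih, hk with
    | 0, _, _ => simp [B]; positivity
    | 1, _, hk =>
      have := h1 hk
      simp [Finset.sum_range_succ, B]
      exact_mod_cast this
    | i + 2, ih, hk =>
      have hi1 := ih (i + 1) (by omega) (by omega)
      have hi0 := ih i (by omega) (by omega)
      have him : ∑ j ∈ Finset.range i, B n s j ≤ ∑ j ∈ Finset.range (i + 1), (x j : ℤ) := by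
        rcases i with _ | i
        · simp
        · exact ih i (by omega) (by omega)
      have hh := h i hk
      rw [Finset.sum_range_succ]
      have hC : ((i + 3).choose 2 : ℤ) * 2 = ((i : ℤ) + 2) ^ 2 + (i + 2) := by
        have := Nat.triangle_succ (i + 2)
        rw [Nat.choose_two_right]
        have h2 : 2 ∣ (i + 3) * (i + 3 - 1) := even_iff_two_dvd.1 (Nat.even_mul_pred_self _)
        have h3 := Nat.div_mul_cancel h2
        zify at h3
        rw [show i + 3 - 1 = i + 2 by omega] at h3 ⊢
        push_cast at h3 ⊢
        rw [h3]; ring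
      set S := ∑ j ∈ Finset.range (i + 2 + 2), (x j : ℤ) with hS
      set T := ∑ j ∈ Finset.range (i + 2), B n s j with hT
      suffices hB : B n s (i + 2) ≤ S - T by linarith
      rw [B, Int.ceil_le, div_le_iff₀ (by positivity)]
      have hS4 : S = ∑ j ∈ Finset.range (i + 1), (x j : ℤ) + x (i + 1) + x (i + 2) + x (i + 3) := by
        rw [hS, Finset.sum_range_succ, Finset.sum_range_succ, Finset.sum_range_succ]
      have hT2 : T = ∑ j ∈ Finset.range i, B n s j + B n s i + B n s (i + 1) := by
        rw [hT, Finset.sum_range_succ, Finset.sum_range_succ]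
      rw [hT2, Finset.sum_range_succ _ (i + 2), Finset.sum_range_succ _ (i + 1)] at hi1
      rw [Finset.sum_range_succ, Finset.sum_range_succ _ (i + 1)] at hi0
      have key : 2 * (((partitionsInto (n - s + 1) (i + 2)).card : ℤ) - (i + 2) * B n s (i + 1)
          - B n s i) ≤ (S - T) * (((i : ℤ) + 2) ^ 2 + (i + 2)) := by
        rw [hS4, hT2, ← hC]
        set X := ∑ j ∈ Finset.range (i + 1), (x j : ℤ)
        set Y := ∑ j ∈ Finset.range i, B n s j
        -- Abel summation with k = i + 2: the weights C(k + 1, 2) ≥ k ≥ 1 decrease, so the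
        -- partial-sum inequalities for k - 1, k - 2 and k - 3 enter with nonnegative coefficients
        -- C(k + 1, 2) - k, k - 1 and 1.
        have e1 : 0 ≤ (((i + 3).choose 2 : ℤ) - (i + 2)) *
            (X + x (i + 1) + x (i + 2) - (Y + B n s i + B n s (i + 1))) := by
          refine mul_nonneg ?_ (by linarith)
          nlinarith
        have e2 : 0 ≤ ((i : ℤ) + 1) * (X + x (i + 1) - (Y + B n s i)) :=
          mul_nonneg (by positivity) (by linarith)
        nlinarith
      exact_mod_cast key

end VandermondeCovering

theorem theorem4 (n s : ℕ) (hs : s ≤ n) (P : Finset n.Partition)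
    (hP : VandermondeCovering.IsVandermondeCovering n s P) :
    ∑ i ∈ Finset.range (s / 2 + 1), VandermondeCovering.B n s i ≤ (P.card : ℤ) := by
  open VandermondeCovering in
  rcases lt_or_ge s 2 with hs2 | hs2
  · rw [Nat.div_eq_of_lt hs2]
    simp [B]
  obtain ⟨d, rfl⟩ : ∃ d, s = d + 1 := ⟨s - 1, by omega⟩
  set x : ℕ → ℕ := fun j => (P.filter fun q => Multiset.card (bigParts q.parts) = j).card with hx
  have hcount : ∀ i, i + 1 ≤ (d + 1) / 2 → (partitionsInto (n - d) (i + 1)).card ≤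
      (i + 1 + 1).choose 2 * x (i + 1 + 1) + (i + 1) * x (i + 1) + x i := by
    intro i hi
    rw [← sum_ite_eq_card P x (fun _ => rfl)]
    exact card_partitionsInto_le (by omega) hs hi hP
  have hle := sum_B_le (n := n) (s := d + 1) (K := (d + 1) / 2) x (fun h => ?_) (fun i hi => ?_)
    ((d + 1) / 2) le_rfl
  · refine hle.trans ?_
    rw [← Nat.cast_sum]
    norm_cast
    rw [← Finset.card_biUnion]
    · refine Finset.card_le_card fun q hq => ?_
      obtain ⟨j, _, hj⟩ := Finset.mem_biUnion.1 hq
      exact (Finset.mem_filter.1 hj).1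
    · intro j _ k _ hjk
      refine Finset.disjoint_left.2 fun q hj hk => hjk ?_
      rw [← (Finset.mem_filter.1 hj).2, (Finset.mem_filter.1 hk).2]
  -- The case i = 1 only needs that n - d > 0 has a partition into one part, matching B 1 = 1.
  · have h1 := hcount 0 h
    have h2 : 0 < (partitionsInto (n - d) (0 + 1)).card := by
      refine Finset.card_pos.2 ⟨Nat.Partition.indiscrete _, ?_⟩
      simp [partitionsInto, Nat.Partition.indiscrete_parts (show n - d ≠ 0 by omega)]
    simp only [zero_add] at h1 h2
    simp at h1
    omega
  · have h1 := hcount (i + 1) hi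
    rw [show n - (d + 1) + 1 = n - d by omega]
    have h2 : (((partitionsInto (n - d) (i + 2)).card : ℕ) : ℤ) ≤ _ := Int.ofNat_le.2 h1
    push_cast at h2
    linarith
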